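/- Let $G$ be a finite connected multigraph (loops and multiple edges allowed) that remains connected after the removal of any one edge, and fix an orientation of its edges. Let $\mathcal F(G)\subset\mathbb Z^{E(G)}$ be the lattice of integer flows (the elements whose incoming and outgoing totals agree at every vertex), with the pairing $(x,y)=\sum_{e}x_ey_e$. An oriented circuit is a closed walk that repeats no vertex and no edge; it defines a circuit element of $\mathcal F(G)$ whose coefficients are $+1$ or $-1$ on its edges (according to whether an edge is traversed along or against its orientation) and $0$ elsewhere. Let $\mathcal B=\{C_1,\dots,C_r\}$ be a basis of $\mathcal F(G)$ that consists of circuit elements and is cancellation-free, that is, $|C_i\cap C_j|=|(C_i,C_j)|$ for all $i\ne j$, where $C_i\cap C_j$ is the set of common edges. Let $V(G)$ be the Voronoi cell of $\mathcal F(G)$, i.e. the set of points of the real span $\mathcal F(G)\otimes\mathbb R\subset\mathbb R^{E(G)}$ that are at least as close to $0$ as to any other point of $\mathcal F(G)$. For a circuit element $C$ let $F_C=\{x\in V(G):(x,C)=(C,C)/2\}$. An edge of $V(G)$ is a one-dimensional face (the cell itself, if it is one-dimensional), and $[\epsilon]$ denotes the class of all edges of $V(G)$ parallel to the edge $\epsilon$.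 Write $[\epsilon]\notin F_C$ if no edge in the class $[\epsilon]$ is contained in $F_C$. Let $S_{[\epsilon]}\subset E(G)$ be the set of edges of $G$ that lie in no circuit $C$ for which $F_C$ contains an edge in the class $[\epsilon]$. The 2-cut blocks of $G$ are the classes of the relation "$e=f$, or $e\neq f$ and $G-\{e,f\}$ is disconnected" on $E(G)$. Then there are finitely many parallel classes $[\epsilon]$, and $[\epsilon]\mapsto S_{[\epsilon]}$ is a bijection from the parallel classes of edges of $V(G)$ onto the 2-cut blocks of $G$. Moreover, the system of linear equations $$\sum_{[\epsilon]\notin F_{C_i}}n_{[\epsilon]}=(C_i,C_i)\qquad(1\le i\le r),$$ $$\sum_{[\epsilon]\notin F_{C_i},\ [\epsilon]\notin F_{C_j}}n_{[\epsilon]}=|(C_i,C_j)|\qquad(1\le i,j\le r,\ i\neq j)$$ in the unknowns $n_{[\epsilon]}$, one for each parallel class, has exactly one solution in positive integers, namely $n_{[\epsilon]}=|S_{[\epsilon]}|$. -/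

import Mathlib

open scoped Graph

namespace Graph

/-- A multigraph is connected if it has a vertex and any two vertices are joined by a walk. -/
def IsConnected {α β : Type*} (G : Graph α β) : Prop :=
  V(G).Nonempty ∧ ∀ u ∈ V(G), ∀ v ∈ V(G), Relation.ReflTransGen G.Adj u v

/-- `G` is connected and remains connected after removing any one edge. -/
def IsTwoEdgeConnected {α β : Type*} (G : Graph α β) : Prop :=
  G.IsConnected ∧ ∀ e ∈ E(G), (G.deleteEdges {e}).IsConnected

/-- A 2-cut: two distinct edges whose joint removal disconnects `G`. -/
def IsTwoCut {α β : Type*} (G : Graph α β) (e f : E(G)) : Prop :=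
  e ≠ f ∧ ¬ (G.deleteEdges {e.1, f.1}).IsConnected

/-- The 2-cut blocks: the classes of the relation "equal or forming a 2-cut" on the edges. -/
def IsTwoCutBlock {α β : Type*} (G : Graph α β) (S : Set E(G)) : Prop :=
  ∃ e : E(G), S = {f | e = f ∨ G.IsTwoCut e f}

/-- An orientation of a multigraph: every edge is given a direction. -/
structure Orientation {α β : Type*} (G : Graph α β) where
  tail : E(G) → α
  head : E(G) → α
  isLink : ∀ e : E(G), G.IsLink e.1 (tail e) (head e)

namespace Orientation

open Classical in
/-- The integer flows: elements of `ℤ^E(G)` whose incoming and outgoing totals agree at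
every vertex. -/
noncomputable def flowLattice {α β : Type*} {G : Graph α β} [Fintype E(G)] (ω : G.Orientation) :
    Submodule ℤ (E(G) → ℤ) where
  carrier := {a | ∀ v ∈ V(G),
    (∑ e : E(G) with ω.head e = v, a e) - (∑ e : E(G) with ω.tail e = v, a e) = 0}
  zero_mem' := by
    intro v _
    simp
  add_mem' := by
    intro a b ha hb v hv
    have h1 := ha v hv
    have h2 := hb v hv
    simp only [Pi.add_apply, Finset.sum_add_distrib]
    linarith
  smul_mem' := by
    intro k a ha v hv
    have h1 := ha v hv
    simp only [Pi.smul_apply, ← Finset.smul_sum, ← smul_sub, h1, smul_zero]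

/-- The Euclidean pairing on `ℤ^E(G)`. -/
def pairing {α β : Type*} {G : Graph α β} [Fintype E(G)] (x y : E(G) → ℤ) : ℤ :=
  ∑ e : E(G), x e * y e

/-- An oriented circuit: a closed walk of length `n + 1` (indices are cyclic) that does not repeat
a vertex or an edge. The field `forward` says whether an edge is traversed along its orientation;
a loop may be traversed in either way. -/
structure OrientedCircuit {α β : Type*} {G : Graph α β} (ω : G.Orientation) where
  n : ℕ
  vert : Fin (n + 1) → α
  edge : Fin (n + 1) → E(G)
  forward : Fin (n + 1) → Prop
  vert_injective : Function.Injective vert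
  edge_injective : Function.Injective edge
  step_forward : ∀ i, forward i → ω.tail (edge i) = vert i ∧ ω.head (edge i) = vert (i + 1)
  step_backward : ∀ i, ¬ forward i → ω.head (edge i) = vert i ∧ ω.tail (edge i) = vert (i + 1)

open Classical in
/-- The element of `ℤ^E(G)` given by an oriented circuit. -/
noncomputable def OrientedCircuit.toFlow {α β : Type*} {G : Graph α β} {ω : G.Orientation}
    (C : ω.OrientedCircuit) : E(G) → ℤ :=
  fun e => ∑ i, if C.edge i = e then (if C.forward i then 1 else -1) else 0

/-- The circuit elements of the lattice of integer flows. -/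
def IsCircuitElement {α β : Type*} {G : Graph α β} (ω : G.Orientation) (x : E(G) → ℤ) : Prop :=
  ∃ C : ω.OrientedCircuit, C.toFlow = x

/-- A circuit basis consists of circuit elements only. -/
def IsCircuitBasis {α β : Type*} {G : Graph α β} [Fintype E(G)] {ω : G.Orientation} {r : ℕ}
    (b : Module.Basis (Fin r) ℤ ω.flowLattice) : Prop :=
  ∀ i, ω.IsCircuitElement (b i).1

/-- A circuit basis is cancellation-free if, for any two basis circuits, the number of their common
edges is the absolute value of their pairing. (The edges of a circuit are the support of its
circuit element.) -/
def IsCancellationFree {α β : Type*} {G : Graph α β} [Fintype E(G)] {ω : G.Orientation} {r : ℕ}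
    (b : Module.Basis (Fin r) ℤ ω.flowLattice) : Prop :=
  ∀ i j, i ≠ j →
    ((Function.support (b i).1 ∩ Function.support (b j).1).ncard : ℤ)
      = |pairing (b i).1 (b j).1|

/-- The inclusion of `ℤ^E(G)` in Euclidean space `ℝ^E(G)`. -/
def toEuclidean {α β : Type*} {G : Graph α β} (x : E(G) → ℤ) : EuclideanSpace ℝ E(G) :=
  WithLp.toLp 2 (fun e => (x e : ℝ))

/-- The Voronoi cell of the lattice of integer flows: the points of the real span of the lattice
that are at least as close to the origin as to any other lattice point. -/
def voronoiCell {α β : Type*} {G : Graph α β} [Fintype E(G)] (ω : G.Orientation) :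
    Set (EuclideanSpace ℝ E(G)) :=
  {x | x ∈ Submodule.span ℝ (toEuclidean '' (ω.flowLattice : Set (E(G) → ℤ))) ∧
    ∀ v ∈ ω.flowLattice, dist x 0 ≤ dist x (toEuclidean v)}

/-- The face of the Voronoi cell supported by the perpendicular bisector of `v`; for a circuit
element `C` this is the codimension one face `F_C`. -/
def bisectorFace {α β : Type*} {G : Graph α β} [Fintype E(G)] (ω : G.Orientation)
    (v : E(G) → ℤ) : Set (EuclideanSpace ℝ E(G)) :=
  {x | x ∈ ω.voronoiCell ∧
    inner ℝ x (toEuclidean v) = inner ℝ (toEuclidean v) (toEuclidean v) / 2}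

/-- The edges of the Voronoi cell: its one-dimensional faces. -/
def IsVoronoiEdge {α β : Type*} {G : Graph α β} [Fintype E(G)] (ω : G.Orientation)
    (ε : Set (EuclideanSpace ℝ E(G))) : Prop :=
  ε.Nonempty ∧ IsExposed ℝ ω.voronoiCell ε ∧ Module.finrank ℝ (vectorSpan ℝ ε) = 1

/-- Parallelism of edges of the Voronoi cell. -/
def parallelSetoid {α β : Type*} {G : Graph α β} [Fintype E(G)] (ω : G.Orientation) :
    Setoid {ε : Set (EuclideanSpace ℝ E(G)) // ω.IsVoronoiEdge ε} where
  r ε ε' := (affineSpan ℝ ε.1).Parallel (affineSpan ℝ ε'.1)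
  iseqv :=
    { refl := fun _ => AffineSubspace.Parallel.refl _
      symm := fun h => h.symm
      trans := fun h h' => h.trans h' }

/-- The parallel classes `[ε]` of edges of the Voronoi cell. -/
def ParallelClass {α β : Type*} {G : Graph α β} [Fintype E(G)] (ω : G.Orientation) : Type _ :=
  Quotient ω.parallelSetoid

/-- `[ε] ∉ F_C`: no edge of the parallel class participates in the face `F_C`. -/
def ParallelClass.Avoids {α β : Type*} {G : Graph α β} [Fintype E(G)] {ω : G.Orientation}
    (c : ω.ParallelClass) (C : E(G) → ℤ) : Prop :=
  ∀ ε : {ε : Set (EuclideanSpace ℝ E(G)) // ω.IsVoronoiEdge ε},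
    Quotient.mk ω.parallelSetoid ε = c → ¬ ε.1 ⊆ ω.bisectorFace C

/-- The set `S_[ε]` of edges of `G`: the complement of the subgraph `H` corresponding to the
parallel class `[ε]`, where `H` is the union of the circuits `C` whose face `F_C` contains an
edge of the class. -/
def ParallelClass.block {α β : Type*} {G : Graph α β} [Fintype E(G)] {ω : G.Orientation}
    (c : ω.ParallelClass) : Set E(G) :=
  {e | ∀ C : E(G) → ℤ, ω.IsCircuitElement C → ¬ c.Avoids C → e ∉ Function.support C}

/-- `m` is a positive integer solution of the linear system attached to the basis `b`: one equation
for each basis circuit, one for each pair of basis circuits. -/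
structure IsPositiveSolution {α β : Type*} {G : Graph α β} [Fintype E(G)] {ω : G.Orientation}
    {r : ℕ} (b : Module.Basis (Fin r) ℤ ω.flowLattice) (m : ω.ParallelClass → ℤ) : Prop where
  pos : ∀ c, 0 < m c
  length : ∀ i, (∑ᶠ (c : ω.ParallelClass) (_ : c.Avoids (b i).1), m c)
    = pairing (b i).1 (b i).1
  intersect : ∀ i j, i ≠ j →
    (∑ᶠ (c : ω.ParallelClass) (_ : c.Avoids (b i).1 ∧ c.Avoids (b j).1), m c)
      = |pairing (b i).1 (b j).1|

end Orientation

end Graph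

/-!
Every real flow is a nonnegative combination of circuits whose signs agree with its own. Hence the
half-spaces given by the circuits imply those given by all flows, and the Voronoi cell is the
orthogonal projection to the flow space of the unit cube centred at the origin: a zonotope
generated by the projections `g e` of the coordinate vectors. Its edges are parallel to the vectors
`g e`, and `g e`, `g f` are parallel exactly if the same flows vanish on `e` and on `f`, which
means that `e = f` or that `{e, f}` is a 2-cut. The face `F_C` contains an edge parallel to `g e`
exactly if `C` does not pass through `e`; so the parallel class of `g e` is mapped to the 2-cut
block of `e`, and the sums of the linear system count common edges of two circuits.

For uniqueness, let `l` be the difference of two solutions. On two circuits of a cancellation-free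
basis the products `x e * y e` have constant sign, so the bilinear form `∑ l c * (x c * y c)`
vanishes on the basis and hence on the lattice. On a circuit it takes the value `∑ l c * |x c|`; by
conformal decomposition this sum vanishes at every real flow, and its second differences isolate
each `l c`.
-/

section ConformalVectors

variable {ι : Type*}

/-- The vector `x` conforms to `w`: on its support it has the same signs as `w`. -/
def Conforms (x w : EuclideanSpace ℝ ι) : Prop :=
  ∀ i, x i ≠ 0 → 0 < x i * w i

variable [Finite ι] {x w : EuclideanSpace ℝ ι} {S : Set (EuclideanSpace ℝ ι)}
  {W : Submodule ℝ (EuclideanSpace ℝ ι)}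

lemma abs_eq_abs_sub_mul_add_mul_abs {s t a : ℝ} (hst : s ≠ 0 → 0 < s * t)
    (hat : s ≠ 0 → a ≤ t / s) : |t| = |t - a * s| + a * |s| := by
  by_cases hs : s = 0
  · simp [hs]
  · have hdiv : 0 < t / s := by
      rw [← mul_div_mul_left t s hs]
      exact div_pos (hst hs) (mul_self_pos.mpr hs)
    obtain ⟨q, rfl⟩ : ∃ q, t = q * s := ⟨t / s, (div_mul_cancel₀ t hs).symm⟩
    rw [mul_div_cancel_right₀ q hs] at hdiv hat
    rw [← sub_mul, abs_mul, abs_mul, abs_of_pos hdiv, abs_of_nonneg (sub_nonneg.mpr (hat hs))]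
    ring

lemma Conforms.exists_sub_smul (hxw : Conforms x w) (hx : x ≠ 0) :
    ∃ a > 0, (∃ i, w i ≠ 0 ∧ (w - a • x) i = 0) ∧
      ∀ i, |w i| = |(w - a • x) i| + a * |x i| := by
  classical
  have := Fintype.ofFinite ι
  obtain ⟨j, hj⟩ : ∃ j, x j ≠ 0 := by
    by_contra! h
    exact hx (PiLp.ext h)
  obtain ⟨k, hk, hmin⟩ := Finset.exists_min_image {i | x i ≠ 0} (fun i => w i / x i) ⟨j, by simpa⟩
  simp only [Finset.mem_filter, Finset.mem_univ, true_and] at hk hmin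
  have hpos : 0 < w k / x k := by
    rw [← mul_div_mul_left _ _ hk]
    exact div_pos (hxw k hk) (mul_self_pos.mpr hk)
  refine ⟨w k / x k, hpos, ⟨k, right_ne_zero_of_mul (hxw k hk).ne', ?_⟩, fun i => ?_⟩
  · simp [div_mul_cancel₀ _ hk]
  · exact abs_eq_abs_sub_mul_add_mul_abs (hxw i) (hmin i)

/-- A set of nonzero vectors of `W` such that every nonzero vector of `W` has a member of the set
conforming to it. The model is the set of circuits in the space of flows on a graph. -/
structure IsConformallyGenerating (S : Set (EuclideanSpace ℝ ι))
    (W : Submodule ℝ (EuclideanSpace ℝ ι)) : Prop where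
  subset : S ⊆ W
  ne_zero : ∀ s ∈ S, s ≠ 0
  exists_conforms : ∀ w ∈ W, w ≠ 0 → ∃ s ∈ S, Conforms s w

namespace IsConformallyGenerating

/-- Peel off conforming multiples of members of `S`; each of them shrinks the support. -/
theorem induction (hS : IsConformallyGenerating S W) {P : EuclideanSpace ℝ ι → Prop} (zero : P 0)
    (add_smul : ∀ w, ∀ s ∈ S, ∀ a > 0, (∀ i, |(w + a • s) i| = |w i| + a * |s i|) → P w →
      P (w + a • s)) (hw : w ∈ W) : P w := by
  classical
  have := Fintype.ofFinite ι
  induction hn : ({i | w i ≠ 0} : Finset ι).card using Nat.strong_induction_on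
    generalizing w with
  | _ n ih =>
    subst hn
    by_cases hw0 : w = 0
    · exact hw0 ▸ zero
    obtain ⟨s, hs, hsw⟩ := hS.exists_conforms w hw hw0
    obtain ⟨a, ha, ⟨k, hwk, hk⟩, habs⟩ := hsw.exists_sub_smul (hS.ne_zero s hs)
    have hsubset : ∀ i, (w - a • s) i ≠ 0 → w i ≠ 0 := by
      intro i hi hwi
      have := abs_pos.mpr hi
      have := habs i
      rw [hwi, abs_zero] at this
      have : 0 ≤ a * |s i| := by positivity
      linarith
    have hcard : ({i | (w - a • s) i ≠ 0} : Finset ι).card < ({i | w i ≠ 0} : Finset ι).card :=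
      Finset.card_lt_card <|
        (Finset.ssubset_iff_of_subset (Finset.monotone_filter_right _ fun i _ => hsubset i)).mpr
          ⟨k, by simpa using hwk, fun hmem => (Finset.mem_filter.mp hmem).2 hk⟩
    have hP := ih _ hcard (sub_mem hw (W.smul_mem a (hS.subset hs))) rfl
    have := add_smul _ s hs a ha (by simpa only [sub_add_cancel] using habs) hP
    rwa [sub_add_cancel] at this

lemma span_eq (hS : IsConformallyGenerating S W) : Submodule.span ℝ S = W := by
  refine le_antisymm (Submodule.span_le.mpr hS.subset) fun w hw => ?_
  exact hS.induction (P := (· ∈ Submodule.span ℝ S)) (zero_mem _) (fun w s hs a _ _ hw =>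
    add_mem hw (Submodule.smul_mem _ a (Submodule.subset_span hs))) hw

lemma forall_eq_zero_imp_iff (hS : IsConformallyGenerating S W) {i j : ι} :
    (∀ s ∈ S, s i = 0 → s j = 0) ↔ ∀ w ∈ W, w i = 0 → w j = 0 := by
  refine ⟨fun h w hw => ?_, fun h s hs => h s (hS.subset hs)⟩
  refine hS.induction (P := fun w => w i = 0 → w j = 0) (fun _ => rfl)
    (fun w s hs a ha habs ih hi => ?_) hw
  have hsum : |w i| + a * |s i| = 0 := by rw [← habs, hi, abs_zero]
  rw [add_eq_zero_iff_of_nonneg (by positivity) (by positivity)] at hsum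
  have hsi : s i = 0 := by simpa [ha.ne'] using hsum.2
  simp [ih (abs_eq_zero.mp hsum.1), h s hs hsi]

lemma sum_mul_abs_eq_zero (hS : IsConformallyGenerating S W) {κ : Type*} [Fintype κ]
    {l : κ → ℝ} {f : κ → ι} (h : ∀ s ∈ S, ∑ c, l c * |s (f c)| = 0) (hw : w ∈ W) :
    ∑ c, l c * |w (f c)| = 0 := by
  refine hS.induction (P := fun w => ∑ c, l c * |w (f c)| = 0) (by simp)
    (fun w s hs a _ habs ih => ?_) hw
  calc ∑ c, l c * |(w + a • s) (f c)|
      = ∑ c, l c * |w (f c)| + a * ∑ c, l c * |s (f c)| := by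
        simp only [habs, mul_add, Finset.sum_add_distrib, Finset.mul_sum, mul_left_comm]
    _ = 0 := by rw [ih, h s hs, mul_zero, add_zero]

omit [Finite ι] in
lemma inner_le_sum_abs [Fintype ι] (hS : IsConformallyGenerating S W) {x : EuclideanSpace ℝ ι}
    (h : ∀ s ∈ S, inner ℝ x s ≤ (∑ i, |s i|) / 2) (hw : w ∈ W) :
    inner ℝ x w ≤ (∑ i, |w i|) / 2 := by
  refine hS.induction (P := fun w => inner ℝ x w ≤ (∑ i, |w i|) / 2) (by simp)
    (fun w s hs a ha habs ih => ?_) hw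
  calc inner ℝ x (w + a • s) = inner ℝ x w + a * inner ℝ x s := by
        rw [inner_add_right, inner_smul_right]
    _ ≤ (∑ i, |w i|) / 2 + a * ((∑ i, |s i|) / 2) := by gcongr; exact h s hs
    _ = (∑ i, |(w + a • s) i|) / 2 := by
        simp only [habs, Finset.sum_add_distrib, ← Finset.mul_sum]
        ring

end IsConformallyGenerating

lemma exists_forall_abs_lt_mul_abs (v w : EuclideanSpace ℝ ι) :
    ∃ N : ℝ, ∀ i, w i ≠ 0 → |v i| < N * |w i| := by
  have := Fintype.ofFinite ι
  refine ⟨1 + ∑ i, |v i / w i|, fun i hi => ?_⟩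
  rw [← div_lt_iff₀ (abs_pos.mpr hi), ← abs_div]
  have : |v i / w i| ≤ ∑ j, |v j / w j| :=
    Finset.single_le_sum (f := fun j => |v j / w j|) (fun _ _ => abs_nonneg _) (Finset.mem_univ i)
  linarith

lemma exists_mem_forall_apply_ne_zero (K : Submodule ℝ (EuclideanSpace ℝ ι)) :
    ∃ w ∈ K, ∀ i, w i = 0 → ∀ y ∈ K, y i = 0 := by
  obtain ⟨w, hw, hne⟩ := Module.Dual.exists_forall_mem_ne_zero_of_forall_exists K
    (fun i : {i // ∃ y ∈ K, y i ≠ 0} => (EuclideanSpace.proj (𝕜 := ℝ) i.1).toLinearMap)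
    (fun i => i.2)
  refine ⟨w, hw, fun i hi y hy => ?_⟩
  by_contra hyi
  exact hne ⟨i, y, hy, hyi⟩ hi

lemma exists_mem_conforms_forall_apply_ne_zero {K : Submodule ℝ (EuclideanSpace ℝ ι)}
    (hx : x ∈ K) : ∃ w ∈ K, Conforms x w ∧ ∀ i, w i = 0 → ∀ y ∈ K, y i = 0 := by
  obtain ⟨v, hv, hne⟩ := exists_mem_forall_apply_ne_zero K
  obtain ⟨N, hN⟩ := exists_forall_abs_lt_mul_abs v x
  have hconf : Conforms x (v + N • x) := by
    intro i hi
    have hpos := mul_lt_mul_of_pos_left (hN i hi) (abs_pos.mpr hi)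
    calc 0 < N * (|x i| * |x i|) - |x i| * |v i| := by linarith
      _ ≤ N * (x i * x i) + x i * v i := by
        rw [abs_mul_abs_self, ← abs_mul]
        linarith [neg_abs_le (x i * v i)]
      _ = x i * (v + N • x) i := by
        simp only [PiLp.add_apply, PiLp.smul_apply, smul_eq_mul]
        ring
  refine ⟨v + N • x, add_mem hv (K.smul_mem N hx), hconf, fun i hi => hne i ?_⟩
  have hxi : x i = 0 := by
    by_contra h
    exact (hconf i h).ne' (by rw [hi, mul_zero])
  simpa [hxi] using hi

lemma abs_add_add_abs_sub_of_abs_le {a b : ℝ} (h : |b| ≤ |a|) : |a + b| + |a - b| = 2 * |a| := by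
  grind

/-- The second difference of `t ↦ ∑ c, l c * |(w + t • v) (f c)|` at a vector `w` vanishing at `f c`
but at no other `f d` only sees the kink of the summand `c`. -/
theorem eq_zero_of_forall_sum_mul_abs_eq_zero {κ : Type*} [Fintype κ] {f : κ → ι} {l : κ → ℝ}
    (hne : ∀ c, ∃ v ∈ W, v (f c) ≠ 0)
    (hsep : ∀ c d, (∀ w ∈ W, w (f c) = 0 → w (f d) = 0) → c = d)
    (h : ∀ w ∈ W, ∑ c, l c * |w (f c)| = 0) : l = 0 := by
  classical
  funext c
  obtain ⟨w, ⟨hw, hwc⟩, hgen⟩ := exists_mem_forall_apply_ne_zero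
    (W ⊓ (EuclideanSpace.proj (𝕜 := ℝ) (f c)).toLinearMap.ker)
  replace hwc : w (f c) = 0 := hwc
  have hwd : ∀ d ≠ c, w (f d) ≠ 0 := fun d hdc h0 =>
    hdc (hsep c d fun y hy hyc => hgen _ h0 y ⟨hy, hyc⟩).symm
  obtain ⟨v, hv, hvc⟩ := hne c
  obtain ⟨N, hN⟩ := exists_forall_abs_lt_mul_abs v w
  set u := N • w with hu
  have huW : u ∈ W := W.smul_mem N hw
  have hsecond : ∑ d, l d * (|u (f d) + v (f d)| + |u (f d) - v (f d)| - 2 * |u (f d)|) = 0 := by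
    calc _ = ∑ d, l d * |(u + v) (f d)| + ∑ d, l d * |(u - v) (f d)|
          - 2 * ∑ d, l d * |u (f d)| := by
          simp only [PiLp.add_apply, PiLp.sub_apply, Finset.mul_sum, ← Finset.sum_add_distrib,
            ← Finset.sum_sub_distrib]
          exact Finset.sum_congr rfl fun d _ => by ring
      _ = 0 := by rw [h _ (add_mem huW hv), h _ (sub_mem huW hv), h _ huW]; norm_num
  rw [Finset.sum_eq_single c ?_ (by simp)] at hsecond
  · have huc : u (f c) = 0 := by simp [hu, hwc]
    rw [huc, zero_add, zero_sub, abs_neg, abs_zero, mul_zero, sub_zero, mul_eq_zero] at hsecond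
    exact hsecond.resolve_right (add_pos (abs_pos.mpr hvc) (abs_pos.mpr hvc)).ne'
  · intro d _ hdc
    have hle : |v (f d)| ≤ |u (f d)| := by
      calc |v (f d)| ≤ N * |w (f d)| := (hN _ (hwd d hdc)).le
        _ ≤ |N| * |w (f d)| := by gcongr; exact le_abs_self N
        _ = |u (f d)| := by simp [hu, abs_mul]
    rw [abs_add_add_abs_sub_of_abs_le hle, sub_self, mul_zero]

end ConformalVectors

section Zonotope

variable {ι : Type*}

/-- The cube with sides of length `1` centred at the origin. -/
def centredCube (ι : Type*) : Set (EuclideanSpace ℝ ι) :=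
  {y | ∀ i, |y i| ≤ 1 / 2}

lemma convex_centredCube : Convex ℝ (centredCube ι) := by
  intro x hx y hy a b ha hb hab i
  calc |(a • x + b • y) i| ≤ |a * x i| + |b * y i| := abs_add_le _ _
    _ = a * |x i| + b * |y i| := by rw [abs_mul, abs_mul, abs_of_nonneg ha, abs_of_nonneg hb]
    _ ≤ a * (1 / 2) + b * (1 / 2) := by gcongr <;> [exact hx i; exact hy i]
    _ = 1 / 2 := by rw [← add_mul, hab, one_mul]

lemma isCompact_centredCube : IsCompact (centredCube ι) := by
  have hcube : WithLp.toLp 2 '' Set.univ.pi (fun _ : ι => Set.Icc (-(1 / 2) : ℝ) (1 / 2)) =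
      centredCube ι := by
    ext y
    refine ⟨?_, fun hy => ⟨y.ofLp, fun i _ => abs_le.mp (hy i), rfl⟩⟩
    rintro ⟨z, hz, rfl⟩ i
    exact abs_le.mpr (hz i trivial)
  exact hcube ▸ (isCompact_univ_pi fun _ => isCompact_Icc).image (PiLp.continuous_toLp 2 _)

/-- Half the sign vector of `w`, a point of the cube maximizing the inner product with `w`. -/
noncomputable def halfSign (w : EuclideanSpace ℝ ι) : EuclideanSpace ℝ ι :=
  WithLp.toLp 2 fun i => (SignType.sign (w i) : ℝ) / 2

lemma abs_halfSign_le (w : EuclideanSpace ℝ ι) (i : ι) : |halfSign w i| ≤ 1 / 2 := by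
  rcases lt_trichotomy (w i) 0 with h | h | h <;> norm_num [halfSign, h]

lemma halfSign_mul (w : EuclideanSpace ℝ ι) (i : ι) : halfSign w i * w i = |w i| / 2 := by
  rw [halfSign, div_mul_eq_mul_div, sign_mul_self]

lemma mul_le_of_mem_centredCube {y : EuclideanSpace ℝ ι} (hy : y ∈ centredCube ι)
    (w : EuclideanSpace ℝ ι) (i : ι) : y i * w i ≤ |w i| / 2 :=
  calc y i * w i ≤ |y i| * |w i| := by rw [← abs_mul]; exact le_abs_self _
    _ ≤ 1 / 2 * |w i| := by gcongr; exact hy i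
    _ = |w i| / 2 := by ring

variable [Fintype ι]

lemma inner_eq_sum_mul (x y : EuclideanSpace ℝ ι) : inner ℝ x y = ∑ i, x i * y i := by
  simp only [PiLp.inner_apply, RCLike.inner_apply, conj_trivial, mul_comm]

lemma inner_halfSign (w : EuclideanSpace ℝ ι) : inner ℝ (halfSign w) w = (∑ i, |w i|) / 2 := by
  simp only [inner_eq_sum_mul, halfSign_mul, Finset.sum_div]

lemma inner_le_of_mem_centredCube {y : EuclideanSpace ℝ ι} (hy : y ∈ centredCube ι)
    (w : EuclideanSpace ℝ ι) : inner ℝ y w ≤ (∑ i, |w i|) / 2 := by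
  rw [inner_eq_sum_mul, Finset.sum_div]
  exact Finset.sum_le_sum fun i _ => mul_le_of_mem_centredCube hy w i

lemma inner_eq_iff_of_mem_centredCube {y w : EuclideanSpace ℝ ι} (hy : y ∈ centredCube ι) :
    inner ℝ y w = (∑ i, |w i|) / 2 ↔ ∀ i, w i ≠ 0 → y i = halfSign w i := by
  rw [inner_eq_sum_mul, Finset.sum_div,
    Finset.sum_eq_sum_iff_of_le fun i _ => mul_le_of_mem_centredCube hy w i]
  refine ⟨fun h i hi => mul_right_cancel₀ hi ?_, fun h i _ => ?_⟩
  · rw [h i (Finset.mem_univ i), halfSign_mul]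
  by_cases hi : w i = 0
  · simp [hi]
  · rw [h i hi, halfSign_mul]

variable (W : Submodule ℝ (EuclideanSpace ℝ ι)) {x w : EuclideanSpace ℝ ι} {i j : ι}

/-- The orthogonal projection of the centred unit cube to the subspace `W`. -/
def zonotope : Set (EuclideanSpace ℝ ι) := W.starProjection '' centredCube ι

/-- The face of the zonotope on which the inner product with `w` is as large as possible. For a
vector `w` of `W` the maximum is `(∑ i, |w i|) / 2`. -/
def zonotopeFace (w : EuclideanSpace ℝ ι) : Set (EuclideanSpace ℝ ι) :=
  {x ∈ zonotope W | inner ℝ x w = (∑ i, |w i|) / 2}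

/-- The projection to `W` of the coordinate vector `i`; the zonotope is the sum of the segments
`[-(g i) / 2, (g i) / 2]` spanned by these generators `g i`. -/
noncomputable def zonotopeGenerator (i : ι) : EuclideanSpace ℝ ι :=
  W.starProjection (EuclideanSpace.basisFun ι ℝ i)

variable {W}

lemma inner_starProjection_eq (hw : w ∈ W) (y : EuclideanSpace ℝ ι) :
    inner ℝ (W.starProjection y) w = inner ℝ y w := by
  rw [Submodule.inner_starProjection_left_eq_right, Submodule.starProjection_eq_self_iff.mpr hw]

lemma inner_zonotopeGenerator (hw : w ∈ W) (i : ι) : inner ℝ (zonotopeGenerator W i) w = w i := by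
  rw [zonotopeGenerator, inner_starProjection_eq hw, ← OrthonormalBasis.repr_apply_apply,
    EuclideanSpace.basisFun_repr]

lemma starProjection_eq_sum_smul_zonotopeGenerator (y : EuclideanSpace ℝ ι) :
    W.starProjection y = ∑ i, y i • zonotopeGenerator W i := by
  conv_lhs => rw [← (EuclideanSpace.basisFun ι ℝ).sum_repr y]
  simp only [map_sum, map_smul, EuclideanSpace.basisFun_repr, zonotopeGenerator]

lemma zonotopeGenerator_ne_zero (hw : w ∈ W) (hi : w i ≠ 0) : zonotopeGenerator W i ≠ 0 := by
  intro h
  rw [← inner_zonotopeGenerator hw, h, inner_zero_left] at hi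
  exact hi rfl

theorem mem_zonotope_iff :
    x ∈ zonotope W ↔ x ∈ W ∧ ∀ w ∈ W, inner ℝ x w ≤ (∑ i, |w i|) / 2 := by
  constructor
  · rintro ⟨y, hy, rfl⟩
    refine ⟨W.starProjection_apply_mem y, fun w hw => ?_⟩
    rw [inner_starProjection_eq hw]
    exact inner_le_of_mem_centredCube hy w
  · rintro ⟨hx, hle⟩
    by_contra hxW
    obtain ⟨φ, u, hφ, hu⟩ := geometric_hahn_banach_closed_point
      (convex_centredCube.linear_image W.starProjection.toLinearMap)
      (isCompact_centredCube.image W.starProjection.continuous).isClosed hxW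
    obtain ⟨v, rfl⟩ := (InnerProductSpace.toDual ℝ _).surjective φ
    simp only [InnerProductSpace.toDual_apply_apply] at hφ hu
    set w := W.starProjection v
    have hw : w ∈ W := W.starProjection_apply_mem v
    refine lt_irrefl (inner ℝ x w) ?_
    calc inner ℝ x w ≤ inner ℝ (halfSign w) w := (hle w hw).trans_eq (inner_halfSign w).symm
      _ = inner ℝ v (W.starProjection (halfSign w)) := by
        rw [real_inner_comm, Submodule.inner_starProjection_left_eq_right]
      _ < u := hφ _ ⟨_, abs_halfSign_le w, rfl⟩
      _ < inner ℝ v x := hu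
      _ = inner ℝ x w := by
        rw [real_inner_comm, ← Submodule.inner_starProjection_left_eq_right,
          Submodule.starProjection_eq_self_iff.mpr hx]

lemma mem_zonotopeFace_iff (hw : w ∈ W) :
    x ∈ zonotopeFace W w ↔
      ∃ y ∈ centredCube ι, (∀ i, w i ≠ 0 → y i = halfSign w i) ∧ W.starProjection y = x := by
  constructor
  · rintro ⟨⟨y, hy, rfl⟩, hinner⟩
    rw [inner_starProjection_eq hw] at hinner
    exact ⟨y, hy, (inner_eq_iff_of_mem_centredCube hy).mp hinner, rfl⟩
  · rintro ⟨y, hy, heq, rfl⟩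
    refine ⟨⟨y, hy, rfl⟩, ?_⟩
    rw [inner_starProjection_eq hw]
    exact (inner_eq_iff_of_mem_centredCube hy).mpr heq

lemma starProjection_halfSign_mem_zonotopeFace (hw : w ∈ W) :
    W.starProjection (halfSign w) ∈ zonotopeFace W w :=
  (mem_zonotopeFace_iff hw).mpr ⟨_, abs_halfSign_le w, fun _ _ => rfl, rfl⟩

lemma zonotopeFace_eq_setOf_forall_inner_le (hw : w ∈ W) :
    zonotopeFace W w = {x ∈ zonotope W | ∀ y ∈ zonotope W, inner ℝ y w ≤ inner ℝ x w} := by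
  ext x
  refine and_congr_right fun hx => ⟨fun heq y hy => ?_, fun hmax => ?_⟩
  · exact heq ▸ (mem_zonotope_iff.mp hy).2 w hw
  · have hface := starProjection_halfSign_mem_zonotopeFace hw
    exact ((mem_zonotope_iff.mp hx).2 w hw).antisymm (hface.2 ▸ hmax _ hface.1)

lemma isExposed_zonotopeFace (hw : w ∈ W) : IsExposed ℝ (zonotope W) (zonotopeFace W w) := fun _ =>
  ⟨InnerProductSpace.toDual ℝ _ w, by
    simpa only [InnerProductSpace.toDual_apply_apply, real_inner_comm w] using
      zonotopeFace_eq_setOf_forall_inner_le hw⟩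

lemma exists_eq_zonotopeFace {B : Set (EuclideanSpace ℝ ι)} (hB : IsExposed ℝ (zonotope W) B)
    (hne : B.Nonempty) : ∃ w ∈ W, B = zonotopeFace W w := by
  obtain ⟨φ, rfl⟩ := hB hne
  obtain ⟨v, rfl⟩ := (InnerProductSpace.toDual ℝ _).surjective φ
  have hinner : ∀ y ∈ zonotope W, inner ℝ v y = inner ℝ y (W.starProjection v) := fun y hy => by
    rw [real_inner_comm, ← Submodule.inner_starProjection_left_eq_right,
      Submodule.starProjection_eq_self_iff.mpr (mem_zonotope_iff.mp hy).1]
  refine ⟨W.starProjection v, W.starProjection_apply_mem v, ?_⟩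
  rw [zonotopeFace_eq_setOf_forall_inner_le (W.starProjection_apply_mem v)]
  ext x
  simp only [InnerProductSpace.toDual_apply_apply, Set.mem_ofPred_eq]
  refine and_congr_right fun hx => forall₂_congr fun y hy => ?_
  rw [hinner y hy, hinner x hx]

lemma zonotopeFace_subset_of_conforms (hx : x ∈ W) (hw : w ∈ W) (hxw : Conforms x w) :
    zonotopeFace W w ⊆ zonotopeFace W x := by
  intro z hz
  obtain ⟨y, hy, heq, rfl⟩ := (mem_zonotopeFace_iff hw).mp hz
  refine (mem_zonotopeFace_iff hx).mpr ⟨y, hy, fun i hi => ?_, rfl⟩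
  have hpos := hxw i hi
  rw [heq i (right_ne_zero_of_mul hpos.ne')]
  rcases pos_and_pos_or_neg_and_neg_of_mul_pos hpos with h | h <;> simp [halfSign, h.1, h.2]

theorem vectorSpan_zonotopeFace (hw : w ∈ W) :
    vectorSpan ℝ (zonotopeFace W w) =
      Submodule.span ℝ (zonotopeGenerator W '' {i | w i = 0}) := by
  classical
  refine le_antisymm (Submodule.span_le.mpr ?_) (Submodule.span_le.mpr ?_)
  · rintro _ ⟨p, hp, q, hq, rfl⟩
    obtain ⟨y, -, hy, rfl⟩ := (mem_zonotopeFace_iff hw).mp hp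
    obtain ⟨z, -, hz, rfl⟩ := (mem_zonotopeFace_iff hw).mp hq
    simp only [vsub_eq_sub]
    rw [← map_sub, starProjection_eq_sum_smul_zonotopeGenerator]
    refine Submodule.sum_mem _ fun i _ => ?_
    by_cases hi : w i = 0
    · exact Submodule.smul_mem _ _ (Submodule.subset_span ⟨i, hi, rfl⟩)
    · simp [hy i hi, hz i hi]
  · rintro _ ⟨i, hi, rfl⟩
    set e := EuclideanSpace.basisFun ι ℝ i with he
    have hmem : W.starProjection (halfSign w + (1 / 2 : ℝ) • e) ∈ zonotopeFace W w := by
      refine (mem_zonotopeFace_iff hw).mpr ⟨_, fun k => ?_, fun k hk => ?_, rfl⟩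
      · by_cases hki : k = i
        · subst hki
          simp [halfSign, he, Set.mem_ofPred.mp hi]
        · simpa [he, hki] using abs_halfSign_le w k
      · have hki : k ≠ i := fun h => hk (h ▸ hi)
        simp [he, hki]
    have hsub := vsub_mem_vectorSpan ℝ hmem (starProjection_halfSign_mem_zonotopeFace hw)
    rw [vsub_eq_sub, ← map_sub, add_sub_cancel_left, map_smul] at hsub
    exact (Submodule.smul_mem_iff _ (by norm_num : (1 / 2 : ℝ) ≠ 0)).mp hsub

lemma inner_eq_zero_of_mem_vectorSpan_zonotopeFace (hx : x ∈ vectorSpan ℝ (zonotopeFace W w)) :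
    inner ℝ x w = 0 := by
  suffices h : vectorSpan ℝ (zonotopeFace W w) ≤ (Submodule.span ℝ {w})ᗮ from
    Submodule.mem_orthogonal_singleton_iff_inner_left.mp (h hx)
  rw [vectorSpan_def, Submodule.span_le]
  rintro _ ⟨y, hy, z, hz, rfl⟩
  refine Submodule.mem_orthogonal_singleton_iff_inner_left.mpr ?_
  simp only [vsub_eq_sub, inner_sub_left, hy.2, hz.2, sub_self]

lemma zonotopeGenerator_mem_span_singleton_iff :
    zonotopeGenerator W j ∈ Submodule.span ℝ {zonotopeGenerator W i} ↔
      ∀ w ∈ W, w i = 0 → w j = 0 := by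
  constructor
  · rintro h w hw hi
    obtain ⟨a, ha⟩ := Submodule.mem_span_singleton.mp h
    rw [← inner_zonotopeGenerator hw j, ← ha, inner_smul_left, inner_zonotopeGenerator hw, hi,
      mul_zero]
  · intro h
    rw [← Submodule.orthogonal_orthogonal (Submodule.span ℝ {zonotopeGenerator W i}),
      Submodule.mem_orthogonal']
    intro v hv
    have hproj : ∀ k, (W.starProjection v) k = inner ℝ (zonotopeGenerator W k) v := fun k => by
      rw [zonotopeGenerator, Submodule.inner_starProjection_left_eq_right,
        ← OrthonormalBasis.repr_apply_apply, EuclideanSpace.basisFun_repr]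
    rw [← hproj]
    refine h _ (W.starProjection_apply_mem v) ?_
    rw [hproj]
    exact Submodule.mem_orthogonal_singleton_iff_inner_right.mp hv

/-- The coordinates `i` and `j` are proportional linear forms on `W`, that is, they have the same
zeros on `W`. -/
def CoordinatesParallel (W : Submodule ℝ (EuclideanSpace ℝ ι)) (i j : ι) : Prop :=
  ∀ w ∈ W, w i = 0 ↔ w j = 0

lemma span_zonotopeGenerator_eq_iff :
    Submodule.span ℝ {zonotopeGenerator W i} = Submodule.span ℝ {zonotopeGenerator W j} ↔
      CoordinatesParallel W i j := by
  rw [le_antisymm_iff, Submodule.span_singleton_le_iff_mem, Submodule.span_singleton_le_iff_mem,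
    zonotopeGenerator_mem_span_singleton_iff, zonotopeGenerator_mem_span_singleton_iff]
  exact ⟨fun h w hw => ⟨h.2 w hw, h.1 w hw⟩,
    fun h => ⟨fun w hw => (h w hw).2, fun w hw => (h w hw).1⟩⟩

omit [Fintype ι] in
lemma coordinatesParallel_of_forall_eq_zero_imp [Finite ι] (h : ∀ w ∈ W, w i = 0 → w j = 0)
    (hj : ∃ w ∈ W, w j ≠ 0) : CoordinatesParallel W i j := by
  have := Fintype.ofFinite ι
  obtain ⟨v, hv, hvj⟩ := hj
  obtain ⟨a, ha⟩ := Submodule.mem_span_singleton.mp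
    (zonotopeGenerator_mem_span_singleton_iff.mpr h)
  have hmul : ∀ w ∈ W, w j = a * w i := fun w hw => by
    rw [← inner_zonotopeGenerator hw j, ← ha, real_inner_smul_left, inner_zonotopeGenerator hw]
  have ha0 : a ≠ 0 := left_ne_zero_of_mul (hmul v hv ▸ hvj)
  exact fun w hw => ⟨h w hw, fun hwj => by simpa [hmul w hw, ha0] using hwj⟩

lemma exists_vectorSpan_zonotopeFace_eq_span (hx : x ∈ W) (hi : x i = 0) :
    ∃ w ∈ W, vectorSpan ℝ (zonotopeFace W w) = Submodule.span ℝ {zonotopeGenerator W i} ∧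
      zonotopeFace W w ⊆ zonotopeFace W x := by
  obtain ⟨w, ⟨hw, hwi⟩, hxw, hgen⟩ := exists_mem_conforms_forall_apply_ne_zero
    (K := W ⊓ (EuclideanSpace.proj (𝕜 := ℝ) i).toLinearMap.ker) ⟨hx, hi⟩
  refine ⟨w, hw, ?_, zonotopeFace_subset_of_conforms hx hw hxw⟩
  rw [vectorSpan_zonotopeFace hw]
  refine le_antisymm (Submodule.span_le.mpr ?_)
    (Submodule.span_mono (Set.singleton_subset_iff.mpr ⟨i, hwi, rfl⟩))
  rintro _ ⟨j, hj, rfl⟩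
  exact zonotopeGenerator_mem_span_singleton_iff.mpr fun y hy hyi => hgen j hj y ⟨hy, hyi⟩

lemma exists_vectorSpan_eq_span_zonotopeGenerator {B : Set (EuclideanSpace ℝ ι)}
    (hB : IsExposed ℝ (zonotope W) B) (hrank : Module.finrank ℝ (vectorSpan ℝ B) = 1) :
    ∃ i, vectorSpan ℝ B = Submodule.span ℝ {zonotopeGenerator W i} := by
  have hne : B.Nonempty := by
    rw [Set.nonempty_iff_ne_empty]
    rintro rfl
    rw [vectorSpan_empty, finrank_bot] at hrank
    exact zero_ne_one hrank
  obtain ⟨w, hw, rfl⟩ := exists_eq_zonotopeFace hB hne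
  obtain ⟨i, hi, hgi⟩ : ∃ i, w i = 0 ∧ zonotopeGenerator W i ≠ 0 := by
    by_contra! h
    have hbot : vectorSpan ℝ (zonotopeFace W w) = ⊥ := by
      rw [vectorSpan_zonotopeFace hw, Submodule.span_eq_bot]
      rintro _ ⟨i, hi, rfl⟩
      exact h i hi
    rw [hbot, finrank_bot] at hrank
    exact zero_ne_one hrank
  refine ⟨i, (Submodule.eq_of_le_of_finrank_eq ?_ ?_).symm⟩
  · rw [vectorSpan_zonotopeFace hw]
    exact Submodule.span_mono (Set.singleton_subset_iff.mpr ⟨i, hi, rfl⟩)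
  · rw [finrank_span_singleton hgi, hrank]

end Zonotope

lemma exists_injective_cycle {U : Type*} [Finite U] [Nonempty U] (T : U → U) :
    ∃ (n : ℕ) (p : Fin (n + 1) → U), Function.Injective p ∧ ∀ i, p (i + 1) = T (p i) := by
  obtain ⟨u⟩ := ‹Nonempty U›
  obtain ⟨x, hx⟩ : ∃ x, x ∈ Function.periodicPts T := by
    obtain ⟨i, j, hij, heq⟩ := Finite.exists_ne_map_eq_of_infinite fun k => T^[k] u
    wlog hlt : i < j generalizing i j
    · exact this j i hij.symm heq.symm (lt_of_le_of_ne (not_lt.mp hlt) hij.symm)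
    refine ⟨T^[i] u, j - i, Nat.sub_pos_of_lt hlt, ?_⟩
    rw [Function.IsPeriodicPt, Function.IsFixedPt, ← Function.iterate_add_apply,
      Nat.sub_add_cancel hlt.le]
    exact heq.symm
  obtain ⟨n, hn⟩ := Nat.exists_eq_add_one.mpr (Function.minimalPeriod_pos_of_mem_periodicPts hx)
  refine ⟨n, fun i => T^[i] x, fun i j hij => Fin.ext ?_, fun i => ?_⟩
  · exact Function.iterate_injOn_Iio_minimalPeriod (i.2.trans_eq hn.symm) (j.2.trans_eq hn.symm) hij
  · calc T^[(i + 1 : Fin (n + 1))] x = T^[(i + 1) % Function.minimalPeriod T x] x := by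
          simp [hn, Fin.val_add]
      _ = T (T^[i] x) := by
          rw [Function.iterate_mod_minimalPeriod_eq, Function.iterate_succ_apply']

lemma sum_mul_mul_eq_zero_of_basis {R L ι κ : Type*} [CommSemiring R] [AddCommMonoid L]
    [Module R L] [Fintype κ] (b : Module.Basis ι R L) (φ : κ → L →ₗ[R] R) {l : κ → R}
    (h : ∀ i j, ∑ c, l c * (φ c (b i) * φ c (b j)) = 0) (x y : L) :
    ∑ c, l c * (φ c x * φ c y) = 0 := by
  have hform : ∑ c, l c • LinearMap.BilinForm.linMulLin (φ c) (φ c) = 0 :=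
    LinearMap.BilinForm.ext_basis b fun i j => by simpa using h i j
  simpa using congrArg (fun B : LinearMap.BilinForm R L => B x y) hform

namespace Graph.Orientation

variable {α β : Type*} {G : Graph α β} {ω : G.Orientation}

lemma head_mem (e : E(G)) : ω.head e ∈ V(G) := (ω.isLink e).right_mem

lemma tail_mem (e : E(G)) : ω.tail e ∈ V(G) := (ω.isLink e).left_mem

lemma deleteEdges_adj_tail_head {F : Set β} {e : E(G)} (he : e.1 ∉ F) :
    (G.deleteEdges F).Adj (ω.tail e) (ω.head e) :=
  ⟨e, (deleteEdges_isLink ..).mpr ⟨ω.isLink e, he⟩⟩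

section FlowSpace

variable [Fintype E(G)]

/-- The boundary of a real chain on the edges: its incoming total minus its outgoing total, at each
point of `α`. -/
noncomputable def boundary (ω : G.Orientation) : EuclideanSpace ℝ E(G) →ₗ[ℝ] α →₀ ℝ :=
  Fintype.linearCombination ℝ
      (fun e => Finsupp.single (ω.head e) (1 : ℝ) - Finsupp.single (ω.tail e) (1 : ℝ)) ∘ₗ
    (WithLp.linearEquiv 2 ℝ (E(G) → ℝ)).toLinearMap

/-- The space of real flows. -/
noncomputable def flowSpace (ω : G.Orientation) : Submodule ℝ (EuclideanSpace ℝ E(G)) :=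
  LinearMap.ker ω.boundary

lemma boundary_apply (w : EuclideanSpace ℝ E(G)) :
    ω.boundary w =
      ∑ e, w e • (Finsupp.single (ω.head e) (1 : ℝ) - Finsupp.single (ω.tail e) (1 : ℝ)) :=
  rfl

lemma boundary_basisFun (e : E(G)) :
    ω.boundary (EuclideanSpace.basisFun E(G) ℝ e) =
      Finsupp.single (ω.head e) 1 - Finsupp.single (ω.tail e) 1 := by
  classical
  rw [boundary_apply, Finset.sum_eq_single e (fun f _ hf => by simp [hf]) (by simp)]
  simp

lemma sum_mul_head_sub_tail_eq_zero {w : EuclideanSpace ℝ E(G)} (hw : w ∈ ω.flowSpace)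
    (h : α → ℝ) : ∑ e, w e * (h (ω.head e) - h (ω.tail e)) = 0 := by
  have := congrArg (Finsupp.linearCombination ℝ h) (LinearMap.mem_ker.mp hw)
  simpa [boundary_apply] using this

lemma exists_boundary_eq_of_reflTransGen (ω : G.Orientation) {F : Set β} {u v : α}
    (h : Relation.ReflTransGen (G.deleteEdges F).Adj u v) :
    ∃ p : EuclideanSpace ℝ E(G), (∀ e : E(G), e.1 ∈ F → p e = 0) ∧
      ω.boundary p = Finsupp.single v 1 - Finsupp.single u 1 := by
  classical
  induction h with
  | refl => exact ⟨0, by simp⟩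
  | @tail b c _ hbc ih =>
    obtain ⟨p, hpF, hp⟩ := ih
    obtain ⟨e, he⟩ := hbc
    obtain ⟨hlink, heF⟩ := (deleteEdges_isLink ..).mp he
    lift e to E(G) using hlink.edge_mem
    have hzero : ∀ f : E(G), f.1 ∈ F → EuclideanSpace.basisFun E(G) ℝ e f = 0 := by
      intro f hf
      have hfe : f ≠ e := fun h => heF (h ▸ hf)
      simp [hfe]
    rcases (ω.isLink e).eq_and_eq_or_eq_and_eq hlink with ⟨rfl, rfl⟩ | ⟨rfl, rfl⟩
    · refine ⟨p + EuclideanSpace.basisFun E(G) ℝ e, fun f hf => ?_, ?_⟩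
      · rw [PiLp.add_apply, hpF f hf, hzero f hf, add_zero]
      · rw [map_add, hp, boundary_basisFun, add_comm, sub_add_sub_cancel]
    · refine ⟨p - EuclideanSpace.basisFun E(G) ℝ e, fun f hf => ?_, ?_⟩
      · rw [PiLp.sub_apply, hpF f hf, hzero f hf, sub_zero]
      · rw [map_sub, hp, boundary_basisFun, sub_sub_sub_cancel_left]

lemma exists_mem_flowSpace_of_isConnected (ω : G.Orientation) {F : Set β} {f : E(G)}
    (hf : f.1 ∈ F) (h : (G.deleteEdges F).IsConnected) :
    ∃ w ∈ ω.flowSpace, w f ≠ 0 ∧ ∀ e : E(G), e.1 ∈ F → e ≠ f → w e = 0 := by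
  classical
  obtain ⟨p, hpF, hp⟩ := ω.exists_boundary_eq_of_reflTransGen
    (h.2 _ (head_mem (ω := ω) f) _ (tail_mem f))
  refine ⟨p + EuclideanSpace.basisFun E(G) ℝ f, ?_, by simp [hpF f hf], fun e he hef => ?_⟩
  · rw [flowSpace, LinearMap.mem_ker, map_add, hp, boundary_basisFun, sub_add_sub_cancel, sub_self]
  · simp [hpF e he, hef]

/-- The indicator of the points reachable from the tail of `f` is a potential which is constant
along all edges outside `insert f F`. -/
lemma reflTransGen_tail_head_of_mem_flowSpace {F : Set β} {f : E(G)}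
    {w : EuclideanSpace ℝ E(G)} (hw : w ∈ ω.flowSpace) (hF : ∀ e : E(G), e.1 ∈ F → w e = 0)
    (hf : w f ≠ 0) :
    Relation.ReflTransGen (G.deleteEdges (insert f.1 F)).Adj (ω.tail f) (ω.head f) := by
  classical
  set R := Relation.ReflTransGen (G.deleteEdges (insert f.1 F)).Adj
  by_contra hcut
  have hconst : ∀ e ≠ f, w e ≠ 0 → (R (ω.tail f) (ω.head e) ↔ R (ω.tail f) (ω.tail e)) := by
    intro e hef hwe
    have hstep : R (ω.tail e) (ω.head e) := .single <| deleteEdges_adj_tail_head <| by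
      rintro (h | h)
      exacts [hef (Subtype.ext h), hwe (hF e h)]
    exact ⟨fun h => h.trans (Std.Symm.symm _ _ hstep), fun h => h.trans hstep⟩
  have hsum := sum_mul_head_sub_tail_eq_zero hw fun z => if R (ω.tail f) z then 1 else 0
  rw [Finset.sum_eq_single f (fun e _ hef => ?_) (by simp)] at hsum
  · rw [if_neg hcut, if_pos Relation.ReflTransGen.refl] at hsum
    exact hf (by linarith)
  · by_cases hwe : w e = 0
    · rw [hwe, zero_mul]
    · simp only [hconst e hef hwe, sub_self, mul_zero]

omit [Fintype E(G)] in
lemma isConnected_deleteEdges_insert {F : Set β} {f : E(G)} (h : (G.deleteEdges F).IsConnected)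
    (hf : Relation.ReflTransGen (G.deleteEdges (insert f.1 F)).Adj (ω.tail f) (ω.head f)) :
    (G.deleteEdges (insert f.1 F)).IsConnected := by
  refine ⟨h.1, fun u hu v hv => ?_⟩
  refine Relation.ReflTransGen.trans_induction_on (h.2 u hu v hv) (fun _ => .refl) ?_
    fun _ _ => .trans
  rintro a b ⟨e, he⟩
  obtain ⟨hlink, heF⟩ := (deleteEdges_isLink ..).mp he
  by_cases hef : e = f.1
  · subst hef
    rcases (ω.isLink f).eq_and_eq_or_eq_and_eq hlink with ⟨rfl, rfl⟩ | ⟨rfl, rfl⟩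
    exacts [hf, Std.Symm.symm _ _ hf]
  · exact .single ⟨e, (deleteEdges_isLink ..).mpr ⟨hlink, by simp [hef, heF]⟩⟩

lemma exists_mem_flowSpace_apply_ne_zero (hG : G.IsTwoEdgeConnected) (ω : G.Orientation)
    (e : E(G)) : ∃ w ∈ ω.flowSpace, w e ≠ 0 := by
  obtain ⟨w, hw, hwe, -⟩ := ω.exists_mem_flowSpace_of_isConnected (F := {e.1}) rfl (hG.2 _ e.2)
  exact ⟨w, hw, hwe⟩

theorem coordinatesParallel_flowSpace_iff (hG : G.IsTwoEdgeConnected) {e f : E(G)} :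
    CoordinatesParallel ω.flowSpace e f ↔ e = f ∨ G.IsTwoCut e f := by
  constructor
  · intro h
    by_contra! hcon
    have hconn : (G.deleteEdges {e.1, f.1}).IsConnected := by
      by_contra hdis
      exact hcon.2 ⟨hcon.1, hdis⟩
    obtain ⟨w, hw, hwf, hzero⟩ := ω.exists_mem_flowSpace_of_isConnected (f := f) (by simp) hconn
    exact hwf ((h w hw).mp (hzero e (by simp) hcon.1))
  · rintro (rfl | ⟨-, hcut⟩)
    · exact fun _ _ => Iff.rfl
    · refine coordinatesParallel_of_forall_eq_zero_imp (fun w hw hwe => ?_)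
        (exists_mem_flowSpace_apply_ne_zero hG ω f)
      by_contra hwf
      have hreach := reflTransGen_tail_head_of_mem_flowSpace (F := {e.1}) hw
        (fun g hg => Subtype.ext (Set.mem_singleton_iff.mp hg) ▸ hwe) hwf
      exact hcut (Set.pair_comm f.1 e.1 ▸ isConnected_deleteEdges_insert (hG.2 _ e.2) hreach)

end FlowSpace

lemma OrientedCircuit.toFlow_edge (C : ω.OrientedCircuit) (i : Fin (C.n + 1))
    [Decidable (C.forward i)] : C.toFlow (C.edge i) = if C.forward i then 1 else -1 := by
  classical
  rw [toFlow, Finset.sum_eq_single i (fun j _ hj => if_neg fun h => hj (C.edge_injective h))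
    (by simp), if_pos rfl]
  congr

lemma OrientedCircuit.toFlow_eq_zero (C : ω.OrientedCircuit) {e : E(G)}
    (he : ∀ i, C.edge i ≠ e) : C.toFlow e = 0 :=
  Finset.sum_eq_zero fun i _ => if_neg (he i)

lemma IsCircuitElement.abs_le_one {x : E(G) → ℤ} (hx : ω.IsCircuitElement x) (e : E(G)) :
    |x e| ≤ 1 := by
  classical
  obtain ⟨C, rfl⟩ := hx
  by_cases he : ∃ i, C.edge i = e
  · obtain ⟨i, rfl⟩ := he
    rw [C.toFlow_edge]
    split_ifs <;> simp
  · simp [C.toFlow_eq_zero (not_exists.mp he)]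

lemma IsCircuitElement.ne_zero {x : E(G) → ℤ} (hx : ω.IsCircuitElement x) : x ≠ 0 := by
  classical
  obtain ⟨C, rfl⟩ := hx
  intro h
  have hedge := C.toFlow_edge 0
  rw [h, Pi.zero_apply] at hedge
  split_ifs at hedge
  simp at hedge

section Lattice

variable [Fintype E(G)]

lemma toEuclidean_mem_flowSpace_iff {x : E(G) → ℤ} :
    toEuclidean x ∈ ω.flowSpace ↔ x ∈ ω.flowLattice := by
  classical
  have happly : ∀ v, ω.boundary (toEuclidean x) v =
      (((∑ e with ω.head e = v, x e) - ∑ e with ω.tail e = v, x e : ℤ) : ℝ) := by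
    intro v
    simp [boundary_apply, Finsupp.finsetSum_apply, Finsupp.single_apply, mul_sub,
      Finset.sum_filter, toEuclidean]
  rw [flowSpace, LinearMap.mem_ker, DFunLike.ext_iff]
  simp only [happly, Finsupp.coe_zero, Pi.zero_apply, Int.cast_eq_zero]
  refine ⟨fun h v _ => by convert h v, fun h v => ?_⟩
  by_cases hv : v ∈ V(G)
  · convert h v hv
  · have hhead : ∀ e, ω.head e ≠ v := fun e he => hv (he ▸ head_mem e)
    have htail : ∀ e, ω.tail e ≠ v := fun e he => hv (he ▸ tail_mem e)
    simp [hhead, htail]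

lemma IsCircuitElement.mem_flowLattice {x : E(G) → ℤ} (hx : ω.IsCircuitElement x) :
    x ∈ ω.flowLattice := by
  classical
  obtain ⟨C, rfl⟩ := hx
  have hsum : toEuclidean C.toFlow = ∑ i, (if C.forward i then (1 : ℝ) else -1) •
      EuclideanSpace.basisFun E(G) ℝ (C.edge i) := by
    ext e
    simp only [toEuclidean, OrientedCircuit.toFlow, Int.cast_sum, WithLp.ofLp_sum,
      Finset.sum_apply]
    refine Finset.sum_congr rfl fun i _ => ?_
    split_ifs with he <;> simp [@eq_comm _ e, he]
  have hstep : ∀ i, ω.boundary ((if C.forward i then (1 : ℝ) else -1) •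
      EuclideanSpace.basisFun E(G) ℝ (C.edge i)) =
        Finsupp.single (C.vert (i + 1)) 1 - Finsupp.single (C.vert i) 1 := by
    intro i
    rw [map_smul, boundary_basisFun]
    by_cases hi : C.forward i
    · rw [if_pos hi, one_smul, (C.step_forward i hi).1, (C.step_forward i hi).2]
    · rw [if_neg hi, neg_smul, one_smul, neg_sub, (C.step_backward i hi).1,
        (C.step_backward i hi).2]
  rw [← toEuclidean_mem_flowSpace_iff, flowSpace, LinearMap.mem_ker, hsum, map_sum]
  simp only [hstep]
  rw [Finset.sum_sub_distrib, sub_eq_zero]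
  exact Equiv.sum_comp (Equiv.addRight (1 : Fin (C.n + 1))) fun i =>
    Finsupp.single (C.vert i) (1 : ℝ)

open Classical in
/-- The end of `e` at which the flow `w` enters it. -/
noncomputable def source (ω : G.Orientation) (w : EuclideanSpace ℝ E(G)) (e : E(G)) : α :=
  if 0 < w e then ω.tail e else ω.head e

open Classical in
/-- The end of `e` at which the flow `w` leaves it. -/
noncomputable def target (ω : G.Orientation) (w : EuclideanSpace ℝ E(G)) (e : E(G)) : α :=
  if 0 < w e then ω.head e else ω.tail e

lemma sum_abs_mul_target_sub_source_eq_zero {w : EuclideanSpace ℝ E(G)} (hw : w ∈ ω.flowSpace)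
    (h : α → ℝ) : ∑ e, |w e| * (h (ω.target w e) - h (ω.source w e)) = 0 := by
  rw [← sum_mul_head_sub_tail_eq_zero hw h]
  refine Finset.sum_congr rfl fun e _ => ?_
  by_cases he : 0 < w e
  · simp only [source, target, if_pos he, abs_of_pos he]
  · simp only [source, target, if_neg he, abs_of_nonpos (not_lt.mp he)]
    ring

lemma exists_source_eq_target {w : EuclideanSpace ℝ E(G)} (hw : w ∈ ω.flowSpace) {e : E(G)}
    (he : w e ≠ 0) : ∃ f, w f ≠ 0 ∧ ω.source w f = ω.target w e := by
  classical
  by_contra! hcon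
  have hsum := sum_abs_mul_target_sub_source_eq_zero hw (Pi.single (ω.target w e) 1)
  refine hsum.not_gt (Finset.sum_pos' (fun f _ => ?_) ⟨e, Finset.mem_univ e, ?_⟩)
  · by_cases hf : w f = 0
    · rw [hf, abs_zero, zero_mul]
    · rw [Pi.single_eq_of_ne (hcon f hf), sub_zero]
      exact mul_nonneg (abs_nonneg _) ((Pi.single_nonneg.mpr zero_le_one : (0 : α → ℝ) ≤ _) _)
  · rw [Pi.single_eq_same, Pi.single_eq_of_ne (hcon e he), sub_zero, mul_one]
    exact abs_pos.mpr he

lemma exists_injective_closed_walk {w : EuclideanSpace ℝ E(G)} (hw : w ∈ ω.flowSpace)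
    (hw0 : w ≠ 0) : ∃ (n : ℕ) (v : Fin (n + 1) → α) (e : Fin (n + 1) → E(G)),
      Function.Injective v ∧
        ∀ i, w (e i) ≠ 0 ∧ ω.source w (e i) = v i ∧ ω.target w (e i) = v (i + 1) := by
  obtain ⟨e₀, he₀⟩ : ∃ e, w e ≠ 0 := by
    by_contra! h
    exact hw0 (PiLp.ext h)
  let U := Set.range fun e : {e // w e ≠ 0} => ω.source w e.1
  choose out hout using fun v : U => v.2
  have hnext : ∀ v : U, ω.target w (out v).1 ∈ U := fun v => by
    obtain ⟨f, hf, hft⟩ := exists_source_eq_target hw (out v).2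
    exact ⟨⟨f, hf⟩, hft⟩
  have : Nonempty U := ⟨_, ⟨e₀, he₀⟩, rfl⟩
  obtain ⟨n, p, hp, hsucc⟩ := exists_injective_cycle fun v : U => ⟨_, hnext v⟩
  exact ⟨n, fun i => (p i).1, fun i => (out (p i)).1, Subtype.val_injective.comp hp, fun i =>
    ⟨(out (p i)).2, hout (p i), (congrArg Subtype.val (hsucc i)).symm⟩⟩

theorem exists_isCircuitElement_conforms {w : EuclideanSpace ℝ E(G)} (hw : w ∈ ω.flowSpace)
    (hw0 : w ≠ 0) : ∃ x, ω.IsCircuitElement x ∧ Conforms (toEuclidean x) w := by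
  classical
  obtain ⟨n, v, e, hv, he⟩ := exists_injective_closed_walk hw hw0
  choose hne hsource htarget using he
  let C : ω.OrientedCircuit :=
    { n := n
      vert := v
      edge := e
      forward := fun i => 0 < w (e i)
      vert_injective := hv
      edge_injective := fun i j h => hv <| by rw [← hsource, ← hsource, h]
      step_forward := fun i hi => by
        rw [← hsource, ← htarget, source, target, if_pos hi, if_pos hi]
        exact ⟨rfl, rfl⟩
      step_backward := fun i hi => by
        rw [← hsource, ← htarget, source, target, if_neg hi, if_neg hi]
        exact ⟨rfl, rfl⟩ }
  refine ⟨C.toFlow, ⟨C, rfl⟩, fun f hf => ?_⟩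
  obtain ⟨i, rfl⟩ : ∃ i, C.edge i = f := by
    by_contra! h
    exact hf (by simp [toEuclidean, C.toFlow_eq_zero h])
  simp only [toEuclidean, C.toFlow_edge]
  by_cases hi : C.forward i
  · simpa [if_pos hi] using hi
  · simpa [if_neg hi] using lt_of_le_of_ne (not_lt.mp hi) (hne i)

theorem isConformallyGenerating_circuits (ω : G.Orientation) :
    IsConformallyGenerating (toEuclidean '' {x | ω.IsCircuitElement x}) ω.flowSpace where
  subset := by
    rintro _ ⟨x, hx, rfl⟩
    exact toEuclidean_mem_flowSpace_iff.mpr hx.mem_flowLattice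
  ne_zero := by
    rintro _ ⟨x, hx, rfl⟩ h
    exact hx.ne_zero (funext fun e => by simpa [toEuclidean] using congrArg (· e) h)
  exists_conforms w hw hw0 := by
    obtain ⟨x, hx, hxw⟩ := exists_isCircuitElement_conforms hw hw0
    exact ⟨_, ⟨x, hx, rfl⟩, hxw⟩

lemma span_toEuclidean_flowLattice (ω : G.Orientation) :
    Submodule.span ℝ (toEuclidean '' (ω.flowLattice : Set (E(G) → ℤ))) = ω.flowSpace := by
  refine le_antisymm (Submodule.span_le.mpr ?_) ?_
  · rintro _ ⟨x, hx, rfl⟩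
    exact toEuclidean_mem_flowSpace_iff.mpr hx
  · rw [← ω.isConformallyGenerating_circuits.span_eq]
    exact Submodule.span_mono (Set.image_mono fun x hx => IsCircuitElement.mem_flowLattice hx)

lemma IsCircuitElement.inner_self {x : E(G) → ℤ} (hx : ω.IsCircuitElement x) :
    inner ℝ (toEuclidean x) (toEuclidean x) = ∑ e, |toEuclidean x e| := by
  rw [inner_eq_sum_mul]
  refine Finset.sum_congr rfl fun e _ => ?_
  rcases Int.abs_le_one_iff.mp (hx.abs_le_one e) with h | h | h <;> simp [toEuclidean, h]

theorem voronoiCell_eq_zonotope (ω : G.Orientation) : ω.voronoiCell = zonotope ω.flowSpace := by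
  ext x
  have hdist : ∀ v : E(G) → ℤ, dist x 0 ≤ dist x (toEuclidean v) ↔
      inner ℝ x (toEuclidean v) ≤ inner ℝ (toEuclidean v) (toEuclidean v) / 2 := by
    intro v
    rw [dist_zero_right, dist_eq_norm, ← sq_le_sq₀ (norm_nonneg _) (norm_nonneg _),
      norm_sub_sq_real, real_inner_self_eq_norm_sq]
    constructor <;> intro h <;> linarith
  rw [mem_zonotope_iff, ← span_toEuclidean_flowLattice]
  refine and_congr_right fun _ => ?_
  simp only [hdist, span_toEuclidean_flowLattice]
  constructor
  · intro h w hw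
    refine ω.isConformallyGenerating_circuits.inner_le_sum_abs ?_ hw
    rintro _ ⟨v, hv, rfl⟩
    exact (h v hv.mem_flowLattice).trans_eq (by rw [hv.inner_self])
  · intro h v hv
    refine (h _ (toEuclidean_mem_flowSpace_iff.mpr hv)).trans ?_
    rw [inner_eq_sum_mul]
    gcongr with e
    rw [← sq]
    simp only [toEuclidean]
    exact_mod_cast Int.natCast_natAbs (v e) ▸ Int.natAbs_le_self_sq (v e)

lemma bisectorFace_eq_zonotopeFace {x : E(G) → ℤ} (hx : ω.IsCircuitElement x) :
    ω.bisectorFace x = zonotopeFace ω.flowSpace (toEuclidean x) := by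
  rw [bisectorFace, zonotopeFace, voronoiCell_eq_zonotope, hx.inner_self]

namespace ParallelClass

lemma parallelSetoid_iff {ε ε' : {ε : Set (EuclideanSpace ℝ E(G)) // ω.IsVoronoiEdge ε}} :
    ω.parallelSetoid ε ε' ↔ vectorSpan ℝ ε.1 = vectorSpan ℝ ε'.1 :=
  AffineSubspace.affineSpan_parallel_iff_vectorSpan_eq_and_eq_empty_iff_eq_empty.trans
    (and_iff_left (iff_of_false ε.2.1.ne_empty ε'.2.1.ne_empty))

/-- The line through the origin parallel to the edges of the Voronoi cell in the class. -/
noncomputable def direction : ω.ParallelClass → Submodule ℝ (EuclideanSpace ℝ E(G)) :=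
  Quotient.lift (fun ε => vectorSpan ℝ ε.1) fun _ _ => parallelSetoid_iff.mp

lemma direction_injective :
    Function.Injective (direction : ω.ParallelClass → Submodule ℝ (EuclideanSpace ℝ E(G))) := by
  rintro ⟨ε⟩ ⟨ε'⟩ h
  exact Quotient.sound (parallelSetoid_iff.mpr h)

lemma finrank_direction (c : ω.ParallelClass) : Module.finrank ℝ c.direction = 1 := by
  obtain ⟨ε⟩ := c
  exact ε.2.2.2

lemma exists_direction_eq_span (c : ω.ParallelClass) :
    ∃ e, c.direction = Submodule.span ℝ {zonotopeGenerator ω.flowSpace e} := by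
  obtain ⟨ε⟩ := c
  exact exists_vectorSpan_eq_span_zonotopeGenerator (ω.voronoiCell_eq_zonotope ▸ ε.2.2.1) ε.2.2.2

/-- An edge of `G` representing the class `c`: the edges of the Voronoi cell in `c` are parallel to
the projection of the corresponding coordinate vector to the flow space. -/
noncomputable def edge (c : ω.ParallelClass) : E(G) :=
  c.exists_direction_eq_span.choose

lemma direction_eq_span (c : ω.ParallelClass) :
    c.direction = Submodule.span ℝ {zonotopeGenerator ω.flowSpace c.edge} :=
  c.exists_direction_eq_span.choose_spec

lemma edge_injective : Function.Injective (edge : ω.ParallelClass → E(G)) := fun c d h =>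
  direction_injective (by rw [c.direction_eq_span, d.direction_eq_span, h])

instance finite (ω : G.Orientation) : Finite ω.ParallelClass :=
  Finite.of_injective _ edge_injective

lemma direction_eq_span_iff {c : ω.ParallelClass} {e : E(G)} :
    c.direction = Submodule.span ℝ {zonotopeGenerator ω.flowSpace e} ↔
      CoordinatesParallel ω.flowSpace c.edge e := by
  rw [direction_eq_span, span_zonotopeGenerator_eq_iff]

lemma zonotopeGenerator_edge_ne_zero (c : ω.ParallelClass) :
    zonotopeGenerator ω.flowSpace c.edge ≠ 0 := by
  intro h
  have hrank := c.finrank_direction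
  rw [direction_eq_span, h, Submodule.span_zero_singleton, finrank_bot] at hrank
  exact zero_ne_one hrank

lemma isVoronoiEdge_zonotopeFace {w : EuclideanSpace ℝ E(G)} (hw : w ∈ ω.flowSpace) {e : E(G)}
    (he : zonotopeGenerator ω.flowSpace e ≠ 0)
    (hspan : vectorSpan ℝ (zonotopeFace ω.flowSpace w) =
      Submodule.span ℝ {zonotopeGenerator ω.flowSpace e}) :
    ω.IsVoronoiEdge (zonotopeFace ω.flowSpace w) := by
  refine ⟨⟨_, starProjection_halfSign_mem_zonotopeFace hw⟩, ?_, ?_⟩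
  · rw [voronoiCell_eq_zonotope]
    exact isExposed_zonotopeFace hw
  · rw [hspan, finrank_span_singleton he]

lemma exists_direction_eq (hG : G.IsTwoEdgeConnected) (ω : G.Orientation) (e : E(G)) :
    ∃ c : ω.ParallelClass, c.direction = Submodule.span ℝ {zonotopeGenerator ω.flowSpace e} := by
  obtain ⟨v, hv, hve⟩ := exists_mem_flowSpace_apply_ne_zero hG ω e
  obtain ⟨w, hw, hspan, -⟩ := exists_vectorSpan_zonotopeFace_eq_span (i := e)
    (zero_mem ω.flowSpace) rfl
  exact ⟨Quotient.mk _
    ⟨_, isVoronoiEdge_zonotopeFace hw (zonotopeGenerator_ne_zero hv hve) hspan⟩, hspan⟩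

theorem avoids_iff (c : ω.ParallelClass) {x : E(G) → ℤ} (hx : ω.IsCircuitElement x) :
    c.Avoids x ↔ x c.edge ≠ 0 := by
  have hxW : toEuclidean x ∈ ω.flowSpace := toEuclidean_mem_flowSpace_iff.mpr hx.mem_flowLattice
  rw [Avoids, bisectorFace_eq_zonotopeFace hx]
  refine ⟨fun h hxe => ?_, fun hxe ε hε hsub => hxe ?_⟩
  · obtain ⟨w, hw, hspan, hsub⟩ := exists_vectorSpan_zonotopeFace_eq_span (i := c.edge) hxW
      (by simp [toEuclidean, hxe])
    refine h ⟨_, isVoronoiEdge_zonotopeFace hw c.zonotopeGenerator_edge_ne_zero hspan⟩ ?_ hsub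
    exact direction_injective (hspan.trans c.direction_eq_span.symm)
  · have hmem : zonotopeGenerator ω.flowSpace c.edge ∈ vectorSpan ℝ ε.1 := by
      change _ ∈ direction (Quotient.mk _ ε)
      rw [hε, direction_eq_span]
      exact Submodule.mem_span_singleton_self _
    have hinner := inner_eq_zero_of_mem_vectorSpan_zonotopeFace (vectorSpan_mono ℝ hsub hmem)
    rw [inner_zonotopeGenerator hxW] at hinner
    exact Int.cast_eq_zero.mp hinner

lemma mem_block_iff {c : ω.ParallelClass} {e : E(G)} :
    e ∈ c.block ↔ ∀ w ∈ ω.flowSpace, w c.edge = 0 → w e = 0 := by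
  rw [← ω.isConformallyGenerating_circuits.forall_eq_zero_imp_iff]
  simp only [block, Set.mem_ofPred_eq, Set.forall_mem_image, toEuclidean, Int.cast_eq_zero,
    Function.mem_support, not_not]
  exact forall₂_congr fun x hx => by rw [c.avoids_iff hx, not_not]

lemma mem_block_iff_coordinatesParallel (hG : G.IsTwoEdgeConnected) {c : ω.ParallelClass}
    {e : E(G)} : e ∈ c.block ↔ CoordinatesParallel ω.flowSpace c.edge e :=
  mem_block_iff.trans ⟨fun h => coordinatesParallel_of_forall_eq_zero_imp h
    (exists_mem_flowSpace_apply_ne_zero hG ω e), fun h w hw => (h w hw).mp⟩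

lemma edge_mem_block (c : ω.ParallelClass) : c.edge ∈ c.block :=
  mem_block_iff.mpr fun _ _ => id

lemma eq_of_mem_block (hG : G.IsTwoEdgeConnected) {c d : ω.ParallelClass} {e : E(G)}
    (hc : e ∈ c.block) (hd : e ∈ d.block) : c = d := by
  rw [mem_block_iff_coordinatesParallel hG, ← direction_eq_span_iff] at hc hd
  exact direction_injective (hc.trans hd.symm)

lemma exists_mem_block (hG : G.IsTwoEdgeConnected) (ω : G.Orientation) (e : E(G)) :
    ∃ c : ω.ParallelClass, e ∈ c.block := by
  obtain ⟨c, hc⟩ := exists_direction_eq hG ω e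
  exact ⟨c, (mem_block_iff_coordinatesParallel hG).mpr (direction_eq_span_iff.mp hc)⟩

lemma block_eq_of_mem (hG : G.IsTwoEdgeConnected) {c : ω.ParallelClass} {e : E(G)}
    (he : e ∈ c.block) : c.block = {f | e = f ∨ G.IsTwoCut e f} := by
  rw [mem_block_iff_coordinatesParallel hG] at he
  ext f
  rw [mem_block_iff_coordinatesParallel hG, Set.mem_ofPred_eq,
    ← coordinatesParallel_flowSpace_iff hG]
  exact forall₂_congr fun w hw => by rw [he w hw]

theorem block_bijOn (hG : G.IsTwoEdgeConnected) (ω : G.Orientation) :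
    Set.BijOn (fun c : ω.ParallelClass => c.block) Set.univ {S | G.IsTwoCutBlock S} := by
  refine ⟨fun c _ => ⟨c.edge, block_eq_of_mem hG c.edge_mem_block⟩, fun c _ d _ h => ?_, ?_⟩
  · exact eq_of_mem_block hG c.edge_mem_block ((show c.block = d.block from h) ▸ c.edge_mem_block)
  · rintro _ ⟨e, rfl⟩
    obtain ⟨c, hc⟩ := exists_mem_block hG ω e
    exact ⟨c, trivial, block_eq_of_mem hG hc⟩

lemma avoids_iff_of_mem_block (hG : G.IsTwoEdgeConnected) {c : ω.ParallelClass} {e : E(G)}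
    (he : e ∈ c.block) {x : E(G) → ℤ} (hx : ω.IsCircuitElement x) : c.Avoids x ↔ x e ≠ 0 := by
  have hpar := (mem_block_iff_coordinatesParallel hG).mp he (toEuclidean x)
    (toEuclidean_mem_flowSpace_iff.mpr hx.mem_flowLattice)
  simp only [toEuclidean, Int.cast_eq_zero] at hpar
  rw [c.avoids_iff hx, ne_eq, hpar]

lemma finsum_ncard_block (hG : G.IsTwoEdgeConnected) {x y : E(G) → ℤ}
    (hx : ω.IsCircuitElement x) (hy : ω.IsCircuitElement y) :
    (∑ᶠ (c : ω.ParallelClass) (_ : c.Avoids x ∧ c.Avoids y), (c.block.ncard : ℤ)) =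
      (Function.support x ∩ Function.support y).ncard := by
  have hunion : Function.support x ∩ Function.support y =
      ⋃ c ∈ {c : ω.ParallelClass | c.Avoids x ∧ c.Avoids y}, c.block := by
    ext e
    simp only [Set.mem_iUnion₂, Set.mem_ofPred_eq, Set.mem_inter_iff, Function.mem_support]
    constructor
    · intro he
      obtain ⟨c, hc⟩ := exists_mem_block hG ω e
      exact ⟨c, by rwa [avoids_iff_of_mem_block hG hc hx, avoids_iff_of_mem_block hG hc hy], hc⟩
    · rintro ⟨c, hcxy, hc⟩
      rwa [avoids_iff_of_mem_block hG hc hx, avoids_iff_of_mem_block hG hc hy] at hcxy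
  have hdisj : ({c | c.Avoids x ∧ c.Avoids y} : Set ω.ParallelClass).PairwiseDisjoint block :=
    fun c _ d _ hcd => Set.disjoint_left.mpr fun e hc hd => hcd (eq_of_mem_block hG hc hd)
  rw [hunion, (Set.toFinite _).ncard_biUnion (fun _ _ => Set.toFinite _) hdisj,
    Nat.cast_finsum_mem (Set.toFinite _)]
  rfl

lemma finsum_avoids_eq_sum_mul_abs [Fintype ω.ParallelClass] {x y : E(G) → ℤ}
    (hx : ω.IsCircuitElement x) (hy : ω.IsCircuitElement y) (m : ω.ParallelClass → ℤ) :
    (∑ᶠ (c : ω.ParallelClass) (_ : c.Avoids x ∧ c.Avoids y), m c) =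
      ∑ c, m c * |x c.edge * y c.edge| := by
  classical
  rw [finsum_eq_sum_of_fintype]
  refine Finset.sum_congr rfl fun c _ => ?_
  rw [finsum_eq_if, c.avoids_iff hx, c.avoids_iff hy]
  rcases Int.abs_le_one_iff.mp (hx.abs_le_one c.edge) with h | h | h <;>
    rcases Int.abs_le_one_iff.mp (hy.abs_le_one c.edge) with h' | h' | h' <;> simp [h, h']

end ParallelClass

lemma ncard_support_inter_eq_sum_abs {x y : E(G) → ℤ} (hx : ∀ e, |x e| ≤ 1)
    (hy : ∀ e, |y e| ≤ 1) :
    ((Function.support x ∩ Function.support y).ncard : ℤ) = ∑ e, |x e * y e| := by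
  classical
  have hsupport : Function.support x ∩ Function.support y =
      (({e | x e ≠ 0 ∧ y e ≠ 0} : Finset E(G)) : Set E(G)) := by
    ext e
    simp
  rw [hsupport, Set.ncard_coe_finset, Finset.card_filter]
  push_cast
  refine Finset.sum_congr rfl fun e _ => ?_
  rcases Int.abs_le_one_iff.mp (hx e) with h | h | h <;>
    rcases Int.abs_le_one_iff.mp (hy e) with h' | h' | h' <;> simp [h, h']

lemma pairing_self_nonneg (x : E(G) → ℤ) : 0 ≤ pairing x x :=
  Finset.sum_nonneg fun e _ => mul_self_nonneg (x e)

lemma exists_sign_of_sum_abs_eq_abs_pairing {x y : E(G) → ℤ}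
    (h : ∑ e, |x e * y e| = |pairing x y|) : ∃ s : ℤ, ∀ e, x e * y e = s * |x e * y e| := by
  rcases le_total 0 (pairing x y) with h0 | h0
  · rw [abs_of_nonneg h0, pairing, eq_comm,
      Finset.sum_eq_sum_iff_of_le fun e _ => le_abs_self _] at h
    exact ⟨1, fun e => by rw [one_mul]; exact h e (Finset.mem_univ e)⟩
  · rw [abs_of_nonpos h0, pairing, ← Finset.sum_neg_distrib, eq_comm,
      Finset.sum_eq_sum_iff_of_le fun e _ => neg_le_abs _] at h
    exact ⟨-1, fun e => by rw [← h e (Finset.mem_univ e), neg_one_mul, neg_neg]⟩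

section Basis

variable {r : ℕ} {b : Module.Basis (Fin r) ℤ ω.flowLattice}

lemma sum_abs_mul_eq_abs_pairing (hb : IsCircuitBasis b) (hfree : IsCancellationFree b)
    (i j : Fin r) : ∑ e, |(b i).1 e * (b j).1 e| = |pairing (b i).1 (b j).1| := by
  rcases eq_or_ne i j with rfl | hij
  · rw [abs_of_nonneg (pairing_self_nonneg _), pairing]
    exact Finset.sum_congr rfl fun e _ => abs_mul_self _
  · rw [← hfree i j hij, ncard_support_inter_eq_sum_abs (hb i).abs_le_one (hb j).abs_le_one]

theorem isPositiveSolution_ncard_block (hG : G.IsTwoEdgeConnected) (hb : IsCircuitBasis b)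
    (hfree : IsCancellationFree b) : IsPositiveSolution b fun c => (c.block.ncard : ℤ) := by
  have hsum : ∀ i j, (∑ᶠ (c : ω.ParallelClass) (_ : c.Avoids (b i).1 ∧ c.Avoids (b j).1),
      (c.block.ncard : ℤ)) = |pairing (b i).1 (b j).1| := fun i j => by
    rw [ParallelClass.finsum_ncard_block hG (hb i) (hb j),
      ncard_support_inter_eq_sum_abs (hb i).abs_le_one (hb j).abs_le_one,
      sum_abs_mul_eq_abs_pairing hb hfree]
  refine ⟨fun c => ?_, fun i => ?_, fun i j _ => hsum i j⟩
  · exact_mod_cast Set.ncard_pos (Set.toFinite _) |>.mpr ⟨_, c.edge_mem_block⟩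
  · simpa only [and_self, abs_of_nonneg (pairing_self_nonneg _)] using hsum i i

lemma IsPositiveSolution.sum_mul_abs_eq_abs_pairing [Fintype ω.ParallelClass]
    {m : ω.ParallelClass → ℤ} (hm : IsPositiveSolution b m) (hb : IsCircuitBasis b)
    (i j : Fin r) :
    ∑ c, m c * |(b i).1 c.edge * (b j).1 c.edge| = |pairing (b i).1 (b j).1| := by
  rw [← ParallelClass.finsum_avoids_eq_sum_mul_abs (hb i) (hb j)]
  rcases eq_or_ne i j with rfl | hij
  · simpa only [and_self, abs_of_nonneg (pairing_self_nonneg _)] using hm.length i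
  · exact hm.intersect i j hij

lemma IsPositiveSolution.sum_sub_mul_eq_zero [Fintype ω.ParallelClass]
    {m m' : ω.ParallelClass → ℤ} (hm : IsPositiveSolution b m) (hm' : IsPositiveSolution b m')
    (hb : IsCircuitBasis b) (hfree : IsCancellationFree b) {x y : E(G) → ℤ}
    (hx : x ∈ ω.flowLattice) (hy : y ∈ ω.flowLattice) :
    ∑ c, (m c - m' c) * (x c.edge * y c.edge) = 0 := by
  refine sum_mul_mul_eq_zero_of_basis b
    (fun c : ω.ParallelClass => LinearMap.proj c.edge ∘ₗ ω.flowLattice.subtype) (fun i j => ?_)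
    ⟨x, hx⟩ ⟨y, hy⟩
  obtain ⟨s, hs⟩ :=
    exists_sign_of_sum_abs_eq_abs_pairing (sum_abs_mul_eq_abs_pairing hb hfree i j)
  calc ∑ c, (m c - m' c) * ((b i).1 c.edge * (b j).1 c.edge)
      = s * (∑ c, m c * |(b i).1 c.edge * (b j).1 c.edge| -
          ∑ c, m' c * |(b i).1 c.edge * (b j).1 c.edge|) := by
        rw [← Finset.sum_sub_distrib, Finset.mul_sum]
        refine Finset.sum_congr rfl fun c _ => ?_
        linear_combination (m c - m' c) * hs c.edge
    _ = 0 := by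
        rw [hm.sum_mul_abs_eq_abs_pairing hb, hm'.sum_mul_abs_eq_abs_pairing hb, sub_self, mul_zero]

theorem IsPositiveSolution.unique (hG : G.IsTwoEdgeConnected) {m m' : ω.ParallelClass → ℤ}
    (hm : IsPositiveSolution b m) (hm' : IsPositiveSolution b m') (hb : IsCircuitBasis b)
    (hfree : IsCancellationFree b) : m = m' := by
  have := Fintype.ofFinite ω.ParallelClass
  have hcircuit : ∀ x, ω.IsCircuitElement x → ∑ c, (m c - m' c) * |x c.edge| = 0 := by
    intro x hx
    rw [← hm.sum_sub_mul_eq_zero hm' hb hfree hx.mem_flowLattice hx.mem_flowLattice]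
    refine Finset.sum_congr rfl fun c _ => ?_
    rcases Int.abs_le_one_iff.mp (hx.abs_le_one c.edge) with h | h | h <;> simp [h]
  have hflow : ∀ w ∈ ω.flowSpace, ∑ c, ((m c - m' c : ℤ) : ℝ) * |w c.edge| = 0 := by
    refine fun w => ω.isConformallyGenerating_circuits.sum_mul_abs_eq_zero ?_
    rintro _ ⟨x, hx, rfl⟩
    simp only [toEuclidean]
    exact_mod_cast hcircuit x hx
  have hzero := eq_zero_of_forall_sum_mul_abs_eq_zero (f := ParallelClass.edge)
    (fun c => exists_mem_flowSpace_apply_ne_zero hG ω c.edge)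
    (fun c d h => ParallelClass.eq_of_mem_block hG (ParallelClass.mem_block_iff.mpr h)
      d.edge_mem_block) hflow
  funext c
  exact sub_eq_zero.mp (Int.cast_eq_zero.mp (congrFun hzero c))

end Basis

end Lattice

end Graph.Orientation

theorem mainTheorem3 {α β : Type*} (G : Graph α β) (hV : V(G).Finite) [Fintype E(G)]
    (hG : G.IsTwoEdgeConnected) (ω : G.Orientation) {r : ℕ}
    (b : Module.Basis (Fin r) ℤ ω.flowLattice)
    (hb : Graph.Orientation.IsCircuitBasis b)
    (hfree : Graph.Orientation.IsCancellationFree b) :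
    Finite ω.ParallelClass ∧
    Set.BijOn (fun c : ω.ParallelClass => c.block) Set.univ {S | G.IsTwoCutBlock S} ∧
    Graph.Orientation.IsPositiveSolution b (fun c => (c.block.ncard : ℤ)) ∧
    ∃! m : ω.ParallelClass → ℤ, Graph.Orientation.IsPositiveSolution b m := by
  have hsol := Graph.Orientation.isPositiveSolution_ncard_block hG hb hfree
  exact ⟨inferInstance, Graph.Orientation.ParallelClass.block_bijOn hG ω, hsol, _, hsol,
    fun _ hm => hm.unique hG hsol hb hfree⟩
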